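/- All groups are finite. A formation is an isomorphism-closed class $\mathfrak F$ of groups that is closed under quotients and satisfies $G/(N_1\cap N_2)\in\mathfrak F$ whenever $N_1,N_2\trianglelefteq G$ and $G/N_1,G/N_2\in\mathfrak F$; it is saturated if $G/\Phi(G)\in\mathfrak F$ implies $G\in\mathfrak F$, where $\Phi(G)$ is the Frattini subgroup. Let $\mathfrak U$ be the class of supersoluble groups, and let $\mathrm F(H)$ denote the Fitting subgroup (the largest normal nilpotent subgroup) of $H$. Let $\mathfrak F$ be a saturated formation containing $\mathfrak U$, and let $G$ be a group with a soluble normal subgroup $H$ such that $G/H\in\mathfrak F$. If for every maximal subgroup $M$ of $G$ either $\mathrm F(H)\le M$ or $\mathrm F(H)\cap M$ is a maximal subgroup of $\mathrm F(H)$, then $G\in\mathfrak F$. The converse holds in the case $\mathfrak F=\mathfrak U$: if $G$ is supersoluble and $H$ is a soluble normal subgroup of $G$, then for every maximal subgroup $M$ of $G$ either $\mathrm F(H)\le M$ or $\mathrm F(H)\cap M$ is a maximal subgroup of $\mathrm F(H)$. -/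

import Mathlib

universe u

/-- The Fitting subgroup: the subgroup generated by all normal nilpotent subgroups. -/
def fittingSubgroup (G : Type*) [Group G] : Subgroup G :=
  sSup {N : Subgroup G | N.Normal ∧ Group.IsNilpotent N}

/-- A group is supersoluble if it has a finite series
`1 = s 0 ≤ s 1 ≤ ... ≤ s n = G` of normal subgroups of `G` with cyclic factors. -/
def IsSupersoluble (G : Type*) [Group G] : Prop :=
  ∃ (n : ℕ) (s : ℕ → Subgroup G) (_ : ∀ i, (s i).Normal),
    s 0 = ⊥ ∧ s n = ⊤ ∧
      ∀ i, s i ≤ s (i + 1) ∧ IsCyclic (s (i + 1) ⧸ (s i).subgroupOf (s (i + 1)))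

/-- A property of groups. -/
abbrev GroupClass := ∀ (G : Type u) [Group G], Prop

/-- A formation of finite groups: an isomorphism-closed class of finite groups, closed under
quotients and such that `G ⧸ (N₁ ⊓ N₂)` is in the class whenever `G ⧸ N₁` and `G ⧸ N₂` are. -/
structure IsFormation (𝔉 : GroupClass.{u}) : Prop where
  finite : ∀ (G : Type u) [Group G], 𝔉 G → Finite G
  iso : ∀ (G K : Type u) [Group G] [Group K], G ≃* K → 𝔉 G → 𝔉 K
  quotient : ∀ (G : Type u) [Group G] (N : Subgroup G) [N.Normal], 𝔉 G → 𝔉 (G ⧸ N)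
  subdirect : ∀ (G : Type u) [Group G] (N₁ N₂ : Subgroup G) [N₁.Normal] [N₂.Normal],
    𝔉 (G ⧸ N₁) → 𝔉 (G ⧸ N₂) → 𝔉 (G ⧸ (N₁ ⊓ N₂))

/-- A formation of finite groups is saturated if a finite group `G` belongs to it
whenever `G ⧸ Φ(G)` does. -/
structure IsSaturatedFormation (𝔉 : GroupClass.{u}) : Prop extends IsFormation 𝔉 where
  saturated : ∀ (G : Type u) [Group G] [Finite G], 𝔉 (G ⧸ frattini G) → 𝔉 G

/-- The Fitting subgroup `F(H)` of a subgroup `H` of `G`, as a subgroup of `G`. -/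
def fittingOf {G : Type*} [Group G] (H : Subgroup G) : Subgroup G :=
  (fittingSubgroup H).map H.subtype

/-- For every maximal subgroup `M` of `G`, either `F(H) ≤ M` or
`F(H) ∩ M` is a maximal subgroup of `F(H)`. -/
def FittingMaximalCondition {G : Type*} [Group G] (H : Subgroup G) : Prop :=
  ∀ M : Subgroup G, IsCoatom M →
    fittingOf H ≤ M ∨ IsCoatom ((fittingOf H ⊓ M).subgroupOf (fittingOf H))

/-! Put E = F(H). If M is maximal and E ≰ M, then E ∩ M is maximal in the nilpotent group E, hence
normal in G, and E/(E ∩ M) has prime order, so G induces a cyclic group on it. Let C be the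
intersection of the centralizers of these factors; then G/C ∈ 𝔉 and [C, E] ≤ Φ(G). A Gaschütz
argument (`le_fittingOf_of_commutator_le_frattini`) gives C ∩ H ≤ E, so G/E ∈ 𝔉. By
`IsSaturatedFormation.of_prime_card` every G/(E ∩ M) lies in 𝔉; intersecting kernels gives G/Φ(G) ∈
𝔉, and saturation finishes. For the converse, conjugation acts by powers on the cyclic factors of a
normal series, which forces E ∩ M to be maximal in any normal E ≰ M. -/

open Subgroup

/-! ### Fitting subgroups and Gaschütz's theorem -/

section Fitting

variable {G : Type*} [Group G]

theorem Group.isNilpotent_iff_sylow_normal [Finite G] : Group.IsNilpotent G ↔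
    ∀ (p : ℕ) (_ : Fact p.Prime) (P : Sylow p G), (P : Subgroup G).Normal :=
  Group.isNilpotent_of_finite_tfae.out 0 3

theorem Group.IsNilpotent.exists_normal_relIndex [Finite G] (N : Subgroup G) [N.Normal]
    [Group.IsNilpotent N] (p : ℕ) [Fact p.Prime] :
    ∃ P : Subgroup G, P.Normal ∧ P ≤ N ∧ IsPGroup p P ∧ ¬ p ∣ P.relIndex N := by
  obtain ⟨P⟩ : Nonempty (Sylow p N) := inferInstance
  have hP : (P : Subgroup N).Normal :=
    Group.isNilpotent_iff_sylow_normal.mp ‹_› p ‹_› P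
  have := P.characteristic_of_normal hP
  refine ⟨(P : Subgroup N).map N.subtype, inferInstance, map_subtype_le _, P.2.map _, ?_⟩
  rw [relIndex, subgroupOf, comap_map_eq_self_of_injective N.subtype_injective]
  exact P.not_dvd_index

/-- The normal Sylow p-subgroups of S and T generate a normal p-subgroup of index prime to p, which
is the only Sylow p-subgroup. -/
theorem Group.IsNilpotent.of_sup_eq_top [Finite G] (S T : Subgroup G) [S.Normal] [T.Normal]
    [Group.IsNilpotent S] [Group.IsNilpotent T] (h : S ⊔ T = ⊤) : Group.IsNilpotent G := by
  rw [Group.isNilpotent_iff_sylow_normal]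
  intro p hp P
  obtain ⟨A, hA, hAS, hAp, hAi⟩ := exists_normal_relIndex S p
  obtain ⟨B, hB, hBT, hBp, hBi⟩ := exists_normal_relIndex T p
  have hO : IsPGroup p (A ⊔ B : Subgroup G) := hAp.to_sup_of_normal_right hBp
  have hi : ¬ p ∣ (A ⊔ B).index := by
    rw [← relIndex_mul_index (le_sup_left : A ⊔ B ≤ (A ⊔ B) ⊔ S), hp.out.dvd_mul, not_or]
    constructor
    · rw [relIndex_sup_left]
      exact fun hd => hAi (hd.trans (relIndex_dvd_of_le_left S le_sup_left))
    · have htop : T ⊔ ((A ⊔ B) ⊔ S) = ⊤ :=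
        top_unique (h ▸ sup_le (le_sup_right.trans le_sup_right) le_sup_left)
      rw [← relIndex_top_right, ← htop, relIndex_sup_right]
      exact fun hd => hBi (hd.trans (relIndex_dvd_of_le_left T (le_sup_right.trans le_sup_left)))
  have hn : ((hO.toSylow hi : Sylow p G) : Subgroup G).Normal := by
    rw [IsPGroup.toSylow_coe]; infer_instance
  have := (hO.toSylow hi).unique_of_normal hn
  rwa [Subsingleton.elim P (hO.toSylow hi)]

theorem Group.IsNilpotent.sup [Finite G] (S T : Subgroup G) [S.Normal] [T.Normal]
    [Group.IsNilpotent S] [Group.IsNilpotent T] : Group.IsNilpotent (S ⊔ T : Subgroup G) := by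
  have := (Group.isNilpotent_congr
    (subgroupOfEquivOfLe (le_sup_left : S ≤ S ⊔ T))).mpr inferInstance
  have := (Group.isNilpotent_congr
    (subgroupOfEquivOfLe (le_sup_right : T ≤ S ⊔ T))).mpr inferInstance
  refine of_sup_eq_top (S.subgroupOf (S ⊔ T)) (T.subgroupOf (S ⊔ T)) ?_
  rw [← subgroupOf_sup le_sup_left le_sup_right, subgroupOf_self]

theorem fittingSubgroup_isNilpotent_and_normal (G : Type*) [Group G] [Finite G] :
    (fittingSubgroup G).Normal ∧ Group.IsNilpotent (fittingSubgroup G) := by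
  obtain ⟨F, hF, hmax⟩ :=
    (Set.toFinite {N : Subgroup G | N.Normal ∧ Group.IsNilpotent N}).exists_maximal
      ⟨⊥, inferInstance, inferInstance⟩
  have : fittingSubgroup G = F := by
    refine le_antisymm (sSup_le fun N hN => ?_) (le_sSup hF)
    have := hF.1; have := hF.2; have := hN.1; have := hN.2
    exact le_sup_left.trans (hmax (y := N ⊔ F)
      ⟨inferInstance, Group.IsNilpotent.sup N F⟩ le_sup_right)
  rwa [this]

instance fittingSubgroup_characteristic : (fittingSubgroup G).Characteristic := by
  refine characteristic_iff_map_le.mpr fun φ => ?_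
  rw [map_le_iff_le_comap]
  refine sSup_le fun N hN => ?_
  rw [← map_le_iff_le_comap]
  have := hN.1
  have := hN.2
  exact le_sSup ⟨‹N.Normal›.map _ φ.surjective,
    (Group.isNilpotent_congr (N.equivMapOfInjective _ φ.injective)).mp inferInstance⟩

instance fittingOf_normal (H : Subgroup G) [H.Normal] : (fittingOf H).Normal := by
  unfold fittingOf; infer_instance

instance fittingOf_isNilpotent [Finite G] (H : Subgroup G) : Group.IsNilpotent (fittingOf H) :=
  (Group.isNilpotent_congr ((fittingSubgroup H).equivMapOfInjective _ H.subtype_injective)).mp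
    (fittingSubgroup_isNilpotent_and_normal H).2

theorem le_fittingOf {H B : Subgroup G} [B.Normal] [Group.IsNilpotent B] (h : B ≤ H) :
    B ≤ fittingOf H := by
  rw [← inf_eq_left.mpr h, ← subgroupOf_map_subtype]
  exact map_mono (le_sSup ⟨inferInstance,
    (Group.isNilpotent_congr (subgroupOfEquivOfLe h)).mpr inferInstance⟩)

/-- **Gaschütz**: a normal subgroup that is nilpotent modulo the Frattini subgroup is nilpotent. -/
theorem isNilpotent_of_lowerCentralSeries_le_frattini [Finite G] (B : Subgroup G) [B.Normal]
    (n : ℕ) (h : B.lowerCentralSeries n ≤ frattini G) : Group.IsNilpotent B := by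
  rw [Group.isNilpotent_iff_sylow_normal]
  intro p hp P
  let π := QuotientGroup.mk' (frattini G)
  have hπ : Function.Surjective π := QuotientGroup.mk'_surjective _
  let P' : Subgroup G := (P : Subgroup B).map B.subtype
  have hP'B : P' ≤ B := map_subtype_le _
  have hnil : Group.IsNilpotent (B.map π) := by
    refine isNilpotent_of_lowerCentralSeries_eq_bot (n := n) ?_
    rw [← map_lowerCentralSeries, Subgroup.map_eq_bot_iff, QuotientGroup.ker_mk']
    exact h
  have hBn : (B.map π).Normal := ‹B.Normal›.map π hπ
  have hPn : (P'.map π).Normal := by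
    let Q := P.mapSurjective (π.subgroupMap_surjective B)
    have hQ : (Q : Subgroup (B.map π)).Normal :=
      Group.isNilpotent_iff_sylow_normal.mp hnil p hp Q
    have := Q.characteristic_of_normal hQ
    have : P'.map π = (Q : Subgroup (B.map π)).map (B.map π).subtype := by
      simp only [P', Q, Sylow.coe_mapSurjective, map_map]
      rfl
    rw [this]
    infer_instance
  -- Frattini argument: R = PΦ(G) ∩ B is normal in G with Sylow subgroup P, so G = N(P)R = N(P)Φ(G)
  -- = N(P).
  let R : Subgroup G := (P'.map π).comap π ⊓ B
  have hP'R : P' ≤ R := le_inf (le_comap_map π P') hP'B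
  have hR : R ≤ P' ⊔ frattini G := by
    refine inf_le_left.trans ?_
    rw [comap_map_eq, QuotientGroup.ker_mk']
  have hpR : IsPGroup p (P'.subgroupOf R) :=
    (P.2.map B.subtype).comap_of_injective R.subtype R.subtype_injective
  have hiR : ¬ p ∣ (P'.subgroupOf R).index := by
    intro hd
    have hd' : p ∣ P'.relIndex B := by
      rw [← relIndex_mul_relIndex P' R B hP'R inf_le_right]
      exact hd.mul_right _
    rw [relIndex, subgroupOf, comap_map_eq_self_of_injective B.subtype_injective] at hd'
    exact P.not_dvd_index hd'
  have key := Sylow.normalizer_sup_eq_top (hpR.toSylow hiR)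
  rw [IsPGroup.toSylow_coe, subgroupOf_map_subtype, inf_eq_left.mpr hP'R] at key
  have hN : normalizer (P' : Set G) = ⊤ := by
    refine frattini_nongenerating (top_unique (key ▸ sup_le le_sup_left (hR.trans ?_)))
    exact sup_le_sup_right le_normalizer _
  have : P'.Normal := normalizer_eq_top_iff.mp hN
  exact this.of_map_subtype

/-- A soluble normal subgroup `K ≤ H` with `⁅K, F(H)⁆ ≤ Φ(G)` is contained in `F(H)`. -/
theorem le_fittingOf_of_commutator_le_frattini [Finite G] {H K : Subgroup G}
    [K.Normal] [Group.IsSolvable K] (hKH : K ≤ H) (hK : ⁅K, fittingOf H⁆ ≤ frattini G) :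
    K ≤ fittingOf H := by
  obtain ⟨N, hN⟩ := (Group.isSolvable_def K).mp inferInstance
  -- Climb the derived series: if [B, B] ≤ F(H), then [[B, B], B] ≤ Φ(G), so B is nilpotent.
  have step : ∀ n, (derivedSeries K n).map K.subtype ≤ fittingOf H → K ≤ fittingOf H := by
    intro n
    induction n with
    | zero => intro h; simpa [← MonoidHom.range_eq_map] using h
    | succ n ih =>
      intro h
      refine ih ?_
      set B := (derivedSeries K n).map K.subtype with hB
      have hBK : B ≤ K := map_subtype_le _
      rw [derivedSeries_succ, map_commutator, ← hB] at h
      have hBn : B.Normal := inferInstance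
      have : Group.IsNilpotent B := by
        refine isNilpotent_of_lowerCentralSeries_le_frattini B 2 ?_
        rw [Subgroup.lowerCentralSeries_succ, Subgroup.lowerCentralSeries_succ,
          Subgroup.lowerCentralSeries_zero,
          commutator_comm]
        exact (commutator_mono hBK h).trans hK
      exact le_fittingOf (hBK.trans hKH)
  exact step N (by simp [hN])

end Fitting

/-! ### Supersoluble groups and cyclic actions -/

section Supersoluble

variable {G : Type*} [Group G]

theorem IsSupersoluble.of_isCyclic_of_isCyclic_quotient (A : Subgroup G) [A.Normal] [IsCyclic A]
    [IsCyclic (G ⧸ A)] : IsSupersoluble G := by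
  -- Factors must be cyclic at every index, so the series is constant from 2 on.
  let s : ℕ → Subgroup G := fun i => i.casesOn ⊥ fun j => j.casesOn A fun _ => ⊤
  have hs : ∀ i, (s i).Normal
    | 0 => inferInstanceAs (⊥ : Subgroup G).Normal
    | 1 => ‹A.Normal›
    | _ + 2 => inferInstanceAs (⊤ : Subgroup G).Normal
  refine ⟨2, s, hs, rfl, rfl, fun i => ?_⟩
  match i with
  | 0 =>
    have := QuotientGroup.mk'_surjective ((⊥ : Subgroup G).subgroupOf A)
    have hc := isCyclic_of_surjective _ this
    exact ⟨bot_le, hc⟩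
  | 1 =>
    have := QuotientGroup.map_surjective_of_surjective A (A.subgroupOf ⊤)
      (topEquiv.symm : G ≃* (⊤ : Subgroup G)).toMonoidHom
      ((QuotientGroup.mk'_surjective _).comp topEquiv.symm.surjective) fun x hx => hx
    have hc := isCyclic_of_surjective _ this
    exact ⟨le_top, hc⟩
  | _ + 2 =>
    have := QuotientGroup.map_surjective_of_surjective A ((⊤ : Subgroup G).subgroupOf ⊤)
      (topEquiv.symm : G ≃* (⊤ : Subgroup G)).toMonoidHom
      ((QuotientGroup.mk'_surjective _).comp topEquiv.symm.surjective) fun x _ => trivial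
    have hc := isCyclic_of_surjective _ this
    exact ⟨le_rfl, hc⟩

theorem IsSupersoluble.of_isCyclic [IsCyclic G] : IsSupersoluble G :=
  have : IsCyclic (G ⧸ (⊥ : Subgroup G)) :=
    isCyclic_of_surjective (QuotientGroup.mk' _) (QuotientGroup.mk'_surjective _)
  .of_isCyclic_of_isCyclic_quotient ⊥

/-- The quotient embeds in Aut(N), the cyclic unit group of a prime field. -/
theorem isCyclic_quotient_centralizer_of_prime_card (N : Subgroup G) [N.Normal]
    (hN : (Nat.card N).Prime) : IsCyclic (G ⧸ centralizer (N : Set G)) := by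
  have : Fact (Nat.card N).Prime := ⟨hN⟩
  have : IsCyclic N := isCyclic_of_prime_card rfl
  have : IsCyclic (ZMod (Nat.card N))ˣ := inferInstance
  have : IsCyclic (MulAut N) :=
    isCyclic_of_surjective (IsCyclic.mulAutMulEquiv N).symm
      (IsCyclic.mulAutMulEquiv N).symm.surjective
  have hker : (MulAut.conjNormal : G →* MulAut N).ker = centralizer (N : Set G) := by
    ext g
    simp only [MonoidHom.mem_ker, mem_centralizer_iff, MulEquiv.ext_iff, Subtype.forall,
      Subtype.ext_iff, MulAut.conjNormal_apply, MulAut.one_apply, mul_inv_eq_iff_eq_mul]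
    exact forall₂_congr fun _ _ => eq_comm
  rw [← (QuotientGroup.quotientMulEquivOfEq hker).isCyclic]
  exact isCyclic_of_injective _ (QuotientGroup.kerLift_injective (MulAut.conjNormal : G →* MulAut N))

end Supersoluble

/-! ### Closure properties of formations -/

namespace IsFormation

variable {𝔉 : GroupClass.{u}} {G Q : Type u} [Group G] [Group Q]

theorem quotient_iff_of_surjective (h𝔉 : IsFormation 𝔉) (f : G →* Q) (hf : Function.Surjective f)
    (N : Subgroup G) [N.Normal] (hN : f.ker = N) : 𝔉 (G ⧸ N) ↔ 𝔉 Q := by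
  let e : G ⧸ N ≃* Q := (QuotientGroup.quotientMulEquivOfEq hN).symm.trans
    (QuotientGroup.quotientKerEquivOfSurjective f hf)
  exact ⟨h𝔉.iso _ _ e, h𝔉.iso _ _ e.symm⟩

theorem quotient_mono (h𝔉 : IsFormation 𝔉) {N K : Subgroup G} [N.Normal] [K.Normal] (h : N ≤ K)
    (hN : 𝔉 (G ⧸ N)) : 𝔉 (G ⧸ K) :=
  h𝔉.iso _ _ (QuotientGroup.quotientQuotientEquivQuotient N K h)
    (h𝔉.quotient (G ⧸ N) (K.map (QuotientGroup.mk' N)) hN)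

theorem quotient_iInf (h𝔉 : IsFormation 𝔉) (h1 : 𝔉 (G ⧸ (⊤ : Subgroup G))) {ι : Type*} [Finite ι]
    (N : ι → Subgroup G) [hN : ∀ i, (N i).Normal]
    [(⨅ i, N i).Normal] (h : ∀ i, 𝔉 (G ⧸ N i)) :
    𝔉 (G ⧸ (⨅ i, N i)) := by
  classical
  have := Fintype.ofFinite ι
  have key : ∀ s : Finset ι, ∃ _ : (s.inf N).Normal, 𝔉 (G ⧸ s.inf N) := by
    intro s
    induction s using Finset.induction_on with
    | empty => exact ⟨inferInstanceAs (⊤ : Subgroup G).Normal, h1⟩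
    | insert i s _ ih =>
      obtain ⟨hs, hs'⟩ := ih
      rw [Finset.inf_insert]
      exact ⟨inferInstance, h𝔉.subdirect G _ _ (h i) hs'⟩
  obtain ⟨_, hu⟩ := key Finset.univ
  exact h𝔉.quotient_mono (le_iInf fun i => Finset.inf_le (Finset.mem_univ i)) hu

end IsFormation

namespace IsSaturatedFormation

variable {𝔉 : GroupClass.{u}} {G : Type u} [Group G] [Finite G]

/-- If N ≰ Φ(G), a maximal M complements N, and G is a subdirect product of G/N and the supersoluble
group G/(C(N) ∩ M). -/
theorem of_prime_card (h𝔉 : IsSaturatedFormation 𝔉)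
    (hU : ∀ (K : Type u) [Group K] [Finite K], IsSupersoluble K → 𝔉 K)
    (N : Subgroup G) [N.Normal] (hN : (Nat.card N).Prime) (h : 𝔉 (G ⧸ N)) : 𝔉 G := by
  by_cases hΦ : N ≤ frattini G
  · exact h𝔉.saturated G (h𝔉.quotient_mono hΦ h)
  obtain ⟨M, hM, hNM⟩ : ∃ M : Subgroup G, IsCoatom M ∧ ¬ N ≤ M := by
    by_contra! hcon
    exact hΦ (le_iInf₂ fun M hM => hcon M hM)
  have : Fact (Nat.card N).Prime := ⟨hN⟩
  have : IsCyclic N := isCyclic_of_prime_card rfl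
  have hsup : M ⊔ N = ⊤ := hM.2 _ (left_lt_sup.mpr hNM)
  have hinf : N ⊓ M = ⊥ := by
    rcases (M.subgroupOf N).eq_bot_or_eq_top_of_prime_card with h0 | h1
    · exact disjoint_iff.mp (subgroupOf_eq_bot.mp h0).symm
    · exact absurd (subgroupOf_eq_top.mp h1) hNM
  let C := centralizer (N : Set G)
  have hNC : N ≤ C := le_centralizer N
  have hCM : (C ⊓ M).Normal := by
    rw [← normalizer_eq_top_iff, ← top_le_iff, ← hsup]
    refine sup_le ?_ ?_
    · exact (le_inf le_normalizer_of_normal le_normalizer).trans inf_normalizer_le_normalizer_inf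
    · exact (le_centralizer_iff.mp inf_le_left).trans (centralizer_le_normalizer _)
  have hQ : 𝔉 (G ⧸ (C ⊓ M)) := by
    refine hU _ ?_
    let π := QuotientGroup.mk' (C ⊓ M)
    have hπ : Function.Surjective π := QuotientGroup.mk'_surjective _
    -- Dedekind: C = N(C ∩ M).
    have hCN : C.map π = N.map π := by
      refine le_antisymm (map_le_iff_le_comap.mpr fun c hc => ?_) (map_mono hNC)
      obtain ⟨n, hn, m, hm, rfl⟩ := mem_sup_of_normal_left.mp (sup_comm M N ▸ hsup ▸ mem_top c)
      refine ⟨n, hn, QuotientGroup.eq.mpr ⟨?_, by simpa using hm⟩⟩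
      exact C.mul_mem (C.inv_mem (hNC hn)) hc
    have : (C.map π).Normal := inferInstance
    have : IsCyclic (C.map π) := by
      rw [hCN]
      exact isCyclic_of_surjective _ (π.subgroupMap_surjective N)
    have := isCyclic_quotient_centralizer_of_prime_card N hN
    have : IsCyclic ((G ⧸ (C ⊓ M)) ⧸ C.map π) :=
      isCyclic_of_surjective _
        (QuotientGroup.quotientQuotientEquivQuotient (C ⊓ M) C inf_le_left).symm.surjective
    exact .of_isCyclic_of_isCyclic_quotient (C.map π)
  have h1 := h𝔉.subdirect G N (C ⊓ M) h hQ
  exact (h𝔉.quotient_iff_of_surjective (MonoidHom.id G) Function.surjective_id _ (by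
    rw [MonoidHom.ker_id, eq_comm, eq_bot_iff, ← hinf]
    exact inf_le_inf_left _ inf_le_right)).mp h1

end IsSaturatedFormation

/-! ### The supersoluble converse -/

section Converse

variable {G : Type*} [Group G]

theorem exists_conj_eq_zpow_mod_of_isCyclic {N K : Subgroup G} [N.Normal] [K.Normal]
    [IsCyclic (K ⧸ N.subgroupOf K)] (g : G) :
    ∃ m : ℤ, ∀ x ∈ K, (x ^ m)⁻¹ * (g * x * g⁻¹) ∈ N := by
  let σ : K ⧸ N.subgroupOf K →* K ⧸ N.subgroupOf K :=
    QuotientGroup.map _ _ (MulAut.conjNormal g : MulAut K).toMonoidHom fun x hx => by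
      simpa [mem_subgroupOf] using ‹N.Normal›.conj_mem _ (mem_subgroupOf.mp hx) g
  obtain ⟨m, hm⟩ := σ.map_cyclic
  refine ⟨m, fun x hx => ?_⟩
  have h : ((⟨x, hx⟩ ^ m : K) : K ⧸ N.subgroupOf K) =
    ((MulAut.conjNormal g ⟨x, hx⟩ : K) : K ⧸ N.subgroupOf K) := (hm (⟨x, hx⟩ : K)).symm
  simpa [mem_subgroupOf] using QuotientGroup.eq.mp h

theorem IsSupersoluble.isCoatom_inf_subgroupOf (hG : IsSupersoluble G) (E : Subgroup G) [E.Normal]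
    {M : Subgroup G} (hM : IsCoatom M) (hEM : ¬ E ≤ M) : IsCoatom ((E ⊓ M).subgroupOf E) := by
  obtain ⟨n, s, hs, h0, hn, hstep⟩ := hG
  -- The step at which the series, cut with E, first leaves M.
  obtain ⟨i, hi, hi'⟩ : ∃ i, s i ⊓ E ≤ M ∧ ¬ s (i + 1) ⊓ E ≤ M := by
    by_contra! hcon
    have : ∀ i, s i ⊓ E ≤ M := fun i => by
      induction i with
      | zero => simp [h0]
      | succ i ih => exact hcon i ih
    exact hEM (by simpa [hn] using this n)
  have hcyc := (hstep i).2
  have hMA : M ⊔ s (i + 1) ⊓ E = ⊤ := hM.2 _ (left_lt_sup.mpr hi')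
  have key : ∀ B : Subgroup G, E ⊓ M ≤ B → B ≤ E → B ≤ M ∨ E ≤ B := by
    intro B hB hBE
    let X := B ⊓ s (i + 1)
    have hXE : X ≤ E := inf_le_left.trans hBE
    -- Conjugates of x are powers of x modulo s i ∩ E, which lies in E ∩ M ≤ B.
    have hX : X.Normal := by
      refine ⟨fun x hx g => ?_⟩
      obtain ⟨m, hm⟩ := exists_conj_eq_zpow_mod_of_isCyclic (N := s i) (K := s (i + 1)) g
      have hgx : g * x * g⁻¹ ∈ E := ‹E.Normal›.conj_mem _ (hXE hx) g
      refine ⟨?_, (hs _).conj_mem _ hx.2 g⟩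
      have hE : (x ^ m)⁻¹ * (g * x * g⁻¹) ∈ E := E.mul_mem (E.inv_mem (E.zpow_mem (hXE hx) m)) hgx
      have := B.mul_mem (B.zpow_mem hx.1 m) (hB ⟨hE, hi ⟨hm x hx.2, hE⟩⟩)
      rwa [mul_inv_cancel_left] at this
    by_cases hXM : X ≤ M
    · left
      intro b hb
      obtain ⟨m, hm, a, ha, rfl⟩ := mem_sup_of_normal_right.mp (hMA ▸ mem_top b)
      have hmE : m ∈ E := by simpa using E.mul_mem (hBE hb) (E.inv_mem ha.2)
      have haB : a ∈ B := by simpa using B.mul_mem (B.inv_mem (hB ⟨hmE, hm⟩)) hb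
      exact M.mul_mem hm (hXM ⟨haB, ha.1⟩)
    · right
      have hMX : M ⊔ X = ⊤ := hM.2 _ (left_lt_sup.mpr hXM)
      intro e he
      obtain ⟨m, hm, x, hx, rfl⟩ := mem_sup_of_normal_right.mp (hMX ▸ mem_top e)
      have hmE : m ∈ E := by simpa using E.mul_mem he (E.inv_mem (hXE hx))
      exact B.mul_mem (hB ⟨hmE, hm⟩) hx.1
  refine ⟨fun h => hEM ((subgroupOf_eq_top.mp h).trans inf_le_right), fun X hX => ?_⟩
  have hB : E ⊓ M ≤ X.map E.subtype := by
    have := map_mono (f := E.subtype) hX.le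
    rwa [subgroupOf_map_subtype, inf_eq_left.mpr inf_le_left] at this
  rcases key _ hB (map_subtype_le X) with h | h
  · refine absurd (fun x hx => ?_) hX.not_ge
    exact mem_subgroupOf.mpr ⟨x.2, h (mem_map_of_mem _ hx)⟩
  · refine (eq_top_iff' X).mpr fun x => ?_
    obtain ⟨y, hy, hyx⟩ := h x.2
    rwa [← Subtype.ext hyx]

end Converse

/-! ### The membership theorem -/

section Main

variable {G : Type u} [Group G]

theorem prime_card_of_isCoatom_ker {X Q : Type*} [Group X] [Group Q] [Group.IsSolvable X]
    (f : X →* Q) (hf : Function.Surjective f) (hker : IsCoatom f.ker) : (Nat.card Q).Prime := by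
  have : Group.IsSolvable Q := Group.isSolvable_of_surjective hf
  have : Nontrivial Q := by
    by_contra h
    rw [not_nontrivial_iff_subsingleton] at h
    exact hker.1 ((eq_top_iff' _).mpr fun x => Subsingleton.elim _ _)
  have : IsSimpleGroup Q := ⟨fun S _ => by
    rcases hker.le_iff.mp (f.ker_le_comap S) with h | h
    · right
      rw [← map_comap_eq_self_of_surjective hf S, h, map_top_of_surjective f hf]
    · left
      rw [← map_comap_eq_self_of_surjective hf S, h, Subgroup.map_eq_bot_iff]⟩
  let _ : CommGroup Q := { mul_comm := IsSimpleGroup.comm_iff_isSolvable.mpr inferInstance }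
  exact IsSimpleGroup.prime_card

/-- M normalizes E ∩ M, and so does E, because maximal subgroups of nilpotent groups are normal; G
is generated by M and E. -/
theorem normal_inf_of_isCoatom (E : Subgroup G) [E.Normal] [Group.IsNilpotent E] {M : Subgroup G}
    (hM : IsCoatom M) (hEM : ¬ E ≤ M) (h : IsCoatom ((E ⊓ M).subgroupOf E)) : (E ⊓ M).Normal := by
  have : ((E ⊓ M).subgroupOf E).Normal :=
    Group.normalizerCondition_of_isNilpotent.normal_of_coatom _ h
  rw [← normalizer_eq_top_iff, ← top_le_iff, ← hM.2 _ (left_lt_sup.mpr hEM)]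
  refine sup_le ?_ (le_normalizer_of_normal_subgroupOf inf_le_left)
  exact (le_inf le_normalizer_of_normal le_normalizer).trans inf_normalizer_le_normalizer_inf

theorem prime_card_map_of_isCoatom (E L : Subgroup G) [L.Normal] [Group.IsSolvable E]
    (h : IsCoatom (L.subgroupOf E)) : (Nat.card (E.map (QuotientGroup.mk' L))).Prime := by
  refine prime_card_of_isCoatom_ker ((QuotientGroup.mk' L).subgroupMap E)
    ((QuotientGroup.mk' L).subgroupMap_surjective E) ?_
  convert h
  ext x
  simp [MonoidHom.mem_ker, mem_subgroupOf, Subtype.ext_iff]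

variable [Finite G] {𝔉 : GroupClass.{u}}

theorem IsSaturatedFormation.quotient_of_prime_card (h𝔉 : IsSaturatedFormation 𝔉)
    (hU : ∀ (K : Type u) [Group K] [Finite K], IsSupersoluble K → 𝔉 K)
    {L E : Subgroup G} [L.Normal] [E.Normal] (hLE : L ≤ E)
    (hE : (Nat.card (E.map (QuotientGroup.mk' L))).Prime) (h : 𝔉 (G ⧸ E)) : 𝔉 (G ⧸ L) :=
  h𝔉.of_prime_card hU (E.map (QuotientGroup.mk' L)) hE
    (h𝔉.iso _ _ (QuotientGroup.quotientQuotientEquivQuotient L E hLE).symm h)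

theorem IsSaturatedFormation.mem_of_fittingMaximalCondition (h𝔉 : IsSaturatedFormation 𝔉)
    (hU : ∀ (K : Type u) [Group K] [Finite K], IsSupersoluble K → 𝔉 K)
    (H : Subgroup G) [H.Normal] [Group.IsSolvable H] (hH : 𝔉 (G ⧸ H))
    (hmax : FittingMaximalCondition H) : 𝔉 G := by
  set E := fittingOf H with hE
  let ι := {M : Subgroup G // IsCoatom M ∧ ¬ E ≤ M}
  have hco (M : ι) : IsCoatom ((E ⊓ M.1).subgroupOf E) := (hmax M.1 M.2.1).resolve_left M.2.2
  have hL (M : ι) : (E ⊓ M.1).Normal := normal_inf_of_isCoatom E M.2.1 M.2.2 (hco M)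
  have hprime (M : ι) := prime_card_map_of_isCoatom E (E ⊓ M.1) (hco M)
  have htop : 𝔉 (G ⧸ (⊤ : Subgroup G)) := h𝔉.quotient_mono le_top hH
  let D (M : ι) : Subgroup (G ⧸ (E ⊓ M.1)) :=
    centralizer (E.map (QuotientGroup.mk' (E ⊓ M.1)) : Set (G ⧸ (E ⊓ M.1)))
  have hDn (M : ι) : (D M).Normal := inferInstance
  let C (M : ι) : Subgroup G := (D M).comap (QuotientGroup.mk' (E ⊓ M.1))
  have hCn (M : ι) : (C M).Normal := inferInstance
  have hCn' : (⨅ M, C M).Normal := normal_iInf_normal hCn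
  have hC : 𝔉 (G ⧸ ⨅ M, C M) := by
    refine h𝔉.quotient_iInf htop C fun M => ?_
    have : IsCyclic ((G ⧸ (E ⊓ M.1)) ⧸ D M) :=
      isCyclic_quotient_centralizer_of_prime_card _ (hprime M)
    refine (h𝔉.quotient_iff_of_surjective ((QuotientGroup.mk' (D M)).comp
      (QuotientGroup.mk' (E ⊓ M.1))) ((QuotientGroup.mk'_surjective _).comp
      (QuotientGroup.mk'_surjective _)) _ ?_).mpr (hU _ .of_isCyclic)
    rw [← MonoidHom.comap_ker, QuotientGroup.ker_mk']
  have hCE (M : ι) : ⁅⨅ M, C M, E⁆ ≤ E ⊓ M.1 := by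
    rw [commutator_le]
    intro c hc e he
    have h1 : QuotientGroup.mk' (E ⊓ M.1) c ∈ D M := iInf_le C M hc
    rw [← QuotientGroup.ker_mk' (E ⊓ M.1), MonoidHom.mem_ker, map_commutatorElement,
      commutatorElement_eq_one_iff_mul_comm]
    exact (mem_centralizer_iff.mp h1 _ (mem_map_of_mem _ he)).symm
  have hCΦ : ⁅⨅ M, C M, E⁆ ≤ frattini G := by
    refine le_iInf₂ fun M hM => ?_
    by_cases hEM : E ≤ M
    · exact (commutator_le_right _ _).trans hEM
    · exact (hCE ⟨M, hM, hEM⟩).trans inf_le_right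
  have hKE : (⨅ M, C M) ⊓ H ≤ E := by
    have : Group.IsSolvable ((⨅ M, C M) ⊓ H : Subgroup G) :=
      Group.isSolvable_of_isSolvable_injective (inclusion_injective (inf_le_right : _ ≤ H))
    exact le_fittingOf_of_commutator_le_frattini inf_le_right
      ((commutator_mono inf_le_left le_rfl).trans hCΦ)
  have hGE : 𝔉 (G ⧸ E) := h𝔉.quotient_mono hKE (h𝔉.subdirect G _ _ hC hH)
  have hLn : (⨅ M : ι, E ⊓ M.1).Normal := normal_iInf_normal hL
  have hGL : 𝔉 (G ⧸ ⨅ M : ι, E ⊓ M.1) := h𝔉.quotient_iInf htop _ fun M =>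
    h𝔉.quotient_of_prime_card hU inf_le_left (hprime M) hGE
  -- Each maximal subgroup contains E or some E ∩ M, so the combined kernel lies in Φ(G).
  refine h𝔉.saturated G (h𝔉.quotient_mono ?_ (h𝔉.subdirect G _ _ hGE hGL))
  refine le_iInf₂ fun M hM => ?_
  by_cases hEM : E ≤ M
  · exact inf_le_left.trans hEM
  · exact inf_le_right.trans ((iInf_le _ (⟨M, hM, hEM⟩ : ι)).trans inf_le_right)

end Main

theorem corollary3 (G : Type u) [Group G] [Finite G] (H : Subgroup G) [H.Normal]
    (hH : Group.IsSolvable H) :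
    (∀ 𝔉 : GroupClass.{u}, IsSaturatedFormation 𝔉 →
      (∀ (K : Type u) [Group K] [Finite K], IsSupersoluble K → 𝔉 K) →
      𝔉 (G ⧸ H) → FittingMaximalCondition H → 𝔉 G) ∧
    (IsSupersoluble G → FittingMaximalCondition H) :=
  ⟨fun _ h𝔉 hU hGH hmax => h𝔉.mem_of_fittingMaximalCondition hU H hGH hmax,
    fun hG _ hM => or_iff_not_imp_left.mpr (hG.isCoatom_inf_subgroupOf (fittingOf H) hM)⟩
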